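/- Let $\mathcal A$ be a skeletally small semi-abelian category, i.e. an additive category with kernels and cokernels in which every morphism factors both as a cokernel followed by a monomorphism and as an epimorphism followed by a kernel. A sequence $\xi\colon X\xrightarrow{f}Y\xrightarrow{g}Z$ is short exact if $f$ is a kernel of $g$ and $g$ is a cokernel of $f$. For $a\colon X\to X'$, pushing out $f$ along $a$ gives a complex $a\xi\colon X'\to X'\amalg_XY\to Z$; for $b\colon Z'\to Z$, pulling back $g$ along $b$ gives a complex $\xi b\colon X\to Y\times_ZZ'\to Z'$. A short exact sequence $\xi$ is stable exact if $a\xi$ and $\xi b$ are short exact for all such $a,b$. Let $\operatorname{Ext}^1_{\mathcal A}(Z,X)$ be the set of equivalence classes of stable exact sequences $X\to Y\to Z$ under isomorphisms that are the identity on $X$ and on $Z$; it is an abelian group under the Baer sum $\xi+\xi'=\nabla_X(\xi\oplus\xi')\Delta_Z$, with zero element the class of the split sequence $X\to X\oplus Z\to Z$. The assignments $a\mapsto(\xi\mapsto a\xi)$ and $b\mapsto(\xi\mapsto\xi b)$ make $\operatorname{Ext}^1_{\mathcal A}(Z,-)\colon\mathcal A\to\mathsf{Ab}$ a covariant, and $\operatorname{Ext}^1_{\mathcal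 A}(-,X)\colon\mathcal A^{\mathrm{op}}\to\mathsf{Ab}$ a contravariant, additive functor. For an additive functor $F\colon\mathcal B\to\mathsf{Ab}$ on an additive category $\mathcal B$, an element $x\in F(B)$ is minimal if $x\neq0$ and $F(p)(x)=0$ for every epimorphism $p\colon B\to B'$ in $\mathcal B$ that is not an isomorphism; for a contravariant functor on $\mathcal A$ this is applied with $\mathcal B=\mathcal A^{\mathrm{op}}$. A morphism $f$ is irreducible if it is neither a section nor a retraction and, whenever $f=hg$, either $h$ is a retraction or $g$ is a section. An object is indecomposable if it is non-zero and is not isomorphic to a direct sum of two non-zero objects. Let $X,Z$ be objects of $\mathcal A$ and let $\xi\colon X\xrightarrow{f}Y\xrightarrow{g}Z$ be a stable exact sequence, regarded as an element of $\operatorname{Ext}^1_{\mathcal A}(Z,X)$. (i) If $f$ is irreducible, then $\xi\in\operatorname{Ext}^1_{\mathcal A}(-,X)(Z)$ is minimal, and hence $Z$ is indecomposable. (ii) If $g$ is irreducible, then $\xi\in\operatorname{Ext}^1_{\mathcal A}(Z,-)(X)$ is minimal, and hence $X$ is indecomposable. -/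

import Mathlib

open CategoryTheory CategoryTheory.Limits

universe w v u

namespace SemiAb

section Basic

variable {C : Type u} [Category.{v} C]

/-- A morphism is irreducible if it is neither a section nor a retraction and, in every
factorisation `f = g ≫ h`, either `g` is a section or `h` is a retraction. -/
structure IsIrreducible {X Y : C} (f : X ⟶ Y) : Prop where
  not_section : ¬ IsSplitMono f
  not_retraction : ¬ IsSplitEpi f
  factor : ∀ {W : C} (g : X ⟶ W) (h : W ⟶ Y), f = g ≫ h → IsSplitEpi h ∨ IsSplitMono g

/-- `x ∈ F(X)` is minimal if `x ≠ 0` and `F(p)(x) = 0` for every proper epimorphism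
`p : X ⟶ Y`, i.e. every epimorphism that is not an isomorphism. -/
structure IsMinimal [Preadditive C] (F : C ⥤ Ab.{w}) [F.Additive] {X : C}
    (x : F.obj X) : Prop where
  ne_zero : x ≠ 0
  map_eq_zero : ∀ {Y : C} (p : X ⟶ Y), Epi p → ¬ IsIso p → F.map p x = 0

variable [Preadditive C]

/-- `f` is a kernel of `g`. -/
def IsKer {X Y Z : C} (f : X ⟶ Y) (g : Y ⟶ Z) : Prop :=
  ∃ w : f ≫ g = 0, Nonempty (IsLimit (KernelFork.ofι f w))

/-- `g` is a cokernel of `f`. -/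
def IsCoker {X Y Z : C} (f : X ⟶ Y) (g : Y ⟶ Z) : Prop :=
  ∃ w : f ≫ g = 0, Nonempty (IsColimit (CokernelCofork.ofπ g w))

/-- `f` is the kernel of some morphism. -/
def IsSomeKer {X Y : C} (f : X ⟶ Y) : Prop := ∃ (Z : C) (g : Y ⟶ Z), IsKer f g

/-- `g` is the cokernel of some morphism. -/
def IsSomeCoker {Y Z : C} (g : Y ⟶ Z) : Prop := ∃ (X : C) (f : X ⟶ Y), IsCoker f g

variable (C) in
/-- A preabelian category is an additive category in which every morphism has a kernel and a
cokernel. -/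
class Preabelian : Prop where
  hasFiniteBiproducts : HasFiniteBiproducts C
  hasKernels : HasKernels C
  hasCokernels : HasCokernels C

attribute [instance] Preabelian.hasFiniteBiproducts Preabelian.hasKernels
  Preabelian.hasCokernels

instance [Preabelian C] : HasBinaryBiproducts C := hasBinaryBiproducts_of_finite_biproducts C

variable (C) in
/-- A preabelian category is left semi-abelian if every morphism is a cokernel followed by a
monomorphism, right semi-abelian if every morphism is an epimorphism followed by a kernel, and
semi-abelian if it is both. -/
class SemiAbelian : Prop extends Preabelian C where
  left : ∀ {A B : C} (f : A ⟶ B), ∃ (I : C) (p : A ⟶ I) (i : I ⟶ B),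
    f = p ≫ i ∧ IsSomeCoker p ∧ Mono i
  right : ∀ {A B : C} (f : A ⟶ B), ∃ (I : C) (p : A ⟶ I) (i : I ⟶ B),
    f = p ≫ i ∧ Epi p ∧ IsSomeKer i

theorem isKer_iff {X Y Z : C} {f : X ⟶ Y} {g : Y ⟶ Z} :
    IsKer f g ↔ f ≫ g = 0 ∧ Mono f ∧ ∀ {T : C} (t : T ⟶ Y), t ≫ g = 0 → ∃ u, u ≫ f = t := by
  constructor
  · rintro ⟨w, ⟨h⟩⟩
    refine ⟨w, ⟨fun a b hab => Fork.IsLimit.hom_ext h hab⟩, fun t ht => ?_⟩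
    exact ⟨_, (KernelFork.IsLimit.lift' h t ht).2⟩
  · rintro ⟨w, hm, h⟩
    exact ⟨w, ⟨KernelFork.IsLimit.ofι' f w fun t ht => ⟨(h t ht).choose, (h t ht).choose_spec⟩⟩⟩

theorem isCoker_iff {X Y Z : C} {f : X ⟶ Y} {g : Y ⟶ Z} :
    IsCoker f g ↔ f ≫ g = 0 ∧ Epi g ∧ ∀ {T : C} (t : Y ⟶ T), f ≫ t = 0 → ∃ u, g ≫ u = t := by
  constructor
  · rintro ⟨w, ⟨h⟩⟩
    refine ⟨w, ⟨fun a b hab => Cofork.IsColimit.hom_ext h hab⟩, fun t ht => ?_⟩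
    exact ⟨_, (CokernelCofork.IsColimit.desc' h t ht).2⟩
  · rintro ⟨w, hm, h⟩
    exact ⟨w, ⟨CokernelCofork.IsColimit.ofπ' g w
      fun t ht => ⟨(h t ht).choose, (h t ht).choose_spec⟩⟩⟩

theorem IsSomeKer.isKer {X Y Z : C} {f : X ⟶ Y} (hf : IsSomeKer f) {g : Y ⟶ Z}
    (hg : IsCoker f g) : IsKer f g := by
  obtain ⟨W, k, hk⟩ := hf
  rw [isKer_iff] at hk ⊢
  rw [isCoker_iff] at hg
  obtain ⟨u, rfl⟩ := hg.2.2 k hk.1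
  exact ⟨hg.1, hk.2.1, fun t ht => hk.2.2 t (by rw [← Category.assoc, ht, zero_comp])⟩

theorem IsSomeCoker.isCoker {X Y Z : C} {f : X ⟶ Y} {g : Y ⟶ Z} (hg : IsSomeCoker g)
    (hf : IsKer f g) : IsCoker f g := by
  obtain ⟨W, k, hk⟩ := hg
  rw [isCoker_iff] at hk ⊢
  rw [isKer_iff] at hf
  obtain ⟨u, rfl⟩ := hf.2.2 k hk.1
  exact ⟨hf.1, hk.2.1, fun t ht => hk.2.2 t (by rw [Category.assoc, ht, comp_zero])⟩

/-- A kernel all of whose pushouts are kernels. -/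
def SemiStableKer {X Y : C} (f : X ⟶ Y) : Prop :=
  ∀ ⦃X' P : C⦄ (a : X ⟶ X') (i : X' ⟶ P) (v : Y ⟶ P), IsPushout a f i v → IsSomeKer i

/-- A cokernel all of whose pullbacks are cokernels. -/
def SemiStableCoker {Y Z : C} (g : Y ⟶ Z) : Prop :=
  ∀ ⦃Z' P : C⦄ (b : Z' ⟶ Z) (v : P ⟶ Y) (p : P ⟶ Z'), IsPullback v p g b → IsSomeCoker p

theorem isCoker_of_isPushout {X Y Z X' P : C} {f : X ⟶ Y} {g : Y ⟶ Z} {a : X ⟶ X'}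
    {i : X' ⟶ P} {v : Y ⟶ P} (h : IsPushout a f i v) (hg : IsCoker f g) {p : P ⟶ Z}
    (hi : i ≫ p = 0) (hv : v ≫ p = g) : IsCoker i p := by
  rw [isCoker_iff] at hg ⊢
  subst hv
  have := hg.2.1
  refine ⟨hi, epi_of_epi v p, fun t ht => ?_⟩
  obtain ⟨u, hu⟩ := hg.2.2 (v ≫ t) (by rw [← Category.assoc, ← h.w, Category.assoc, ht, comp_zero])
  exact ⟨u, h.hom_ext (by rw [← Category.assoc, hi, zero_comp, ht])
    (by rw [← Category.assoc, hu])⟩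

theorem isKer_of_isPullback {X Y Z Z' P : C} {f : X ⟶ Y} {g : Y ⟶ Z} {b : Z' ⟶ Z}
    {v : P ⟶ Y} {p : P ⟶ Z'} (h : IsPullback v p g b) (hf : IsKer f g) {i : X ⟶ P}
    (hi : i ≫ p = 0) (hv : i ≫ v = f) : IsKer i p := by
  rw [isKer_iff] at hf ⊢
  subst hv
  have := hf.2.1
  refine ⟨hi, mono_of_mono i v, fun t ht => ?_⟩
  obtain ⟨u, hu⟩ := hf.2.2 (t ≫ v) (by rw [Category.assoc, h.w, ← Category.assoc, ht, zero_comp])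
  exact ⟨u, h.hom_ext (by rw [Category.assoc, hu]) (by rw [Category.assoc, hi, comp_zero, ht])⟩

theorem SemiStableKer.isSomeKer {X Y : C} {f : X ⟶ Y} (hf : SemiStableKer f) : IsSomeKer f :=
  hf (𝟙 X) f (𝟙 Y) (IsPushout.of_horiz_isIso ⟨by simp⟩)

theorem SemiStableCoker.isSomeCoker {Y Z : C} {g : Y ⟶ Z} (hg : SemiStableCoker g) :
    IsSomeCoker g :=
  hg (𝟙 Z) (𝟙 Y) g (IsPullback.of_horiz_isIso ⟨by simp⟩)

theorem SemiStableKer.of_isPushout {X Y X' P : C} {f : X ⟶ Y} (hf : SemiStableKer f)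
    {a : X ⟶ X'} {i : X' ⟶ P} {v : Y ⟶ P} (h : IsPushout a f i v) : SemiStableKer i :=
  fun _ _ _ _ _ h' => hf _ _ _ (h.paste_horiz h')

theorem SemiStableCoker.of_isPullback {Y Z Z' P : C} {g : Y ⟶ Z} (hg : SemiStableCoker g)
    {b : Z' ⟶ Z} {v : P ⟶ Y} {p : P ⟶ Z'} (h : IsPullback v p g b) : SemiStableCoker p :=
  fun _ _ _ _ _ h' => hg _ _ _ (h'.paste_horiz h)

end Basic
end SemiAb

namespace SemiAb

section Stability

variable {C : Type u} [Category.{v} C] [Preadditive C]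

instance [HasBinaryBiproducts C] [HasCokernels C] : HasPushouts C :=
  have := Preadditive.hasCoequalizers_of_hasCokernels (C := C)
  hasPushouts_of_hasBinaryCoproducts_of_hasCoequalizers C

instance [HasBinaryBiproducts C] [HasKernels C] : HasPullbacks C :=
  have := Preadditive.hasEqualizers_of_hasKernels (C := C)
  hasPullbacks_of_hasBinaryProducts_of_hasEqualizers C

theorem exists_isCoker [HasCokernels C] {X Y : C} (f : X ⟶ Y) :
    ∃ (Z : C) (g : Y ⟶ Z), IsCoker f g :=
  ⟨_, cokernel.π f, cokernel.condition f, ⟨cokernelIsCokernel f⟩⟩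

theorem exists_isKer [HasKernels C] {Y Z : C} (g : Y ⟶ Z) :
    ∃ (X : C) (f : X ⟶ Y), IsKer f g :=
  ⟨_, kernel.ι g, kernel.condition g, ⟨kernelIsKernel g⟩⟩

theorem SemiStableKer.of_comp [HasPushouts C] [HasCokernels C]
    {X Y' Y : C} {f' : X ⟶ Y'} {b' : Y' ⟶ Y}
    (hf : SemiStableKer (f' ≫ b')) : SemiStableKer f' := by
  intro X' P a f₂ a'' h
  obtain ⟨Z, g, hg⟩ := exists_isCoker (f' ≫ b')
  obtain ⟨Z', g', hg'⟩ := exists_isCoker f'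
  have hg'' := isCoker_iff.1 hg'
  have hgg := isCoker_iff.1 hg
  obtain ⟨b, hb⟩ := hg''.2.2 (b' ≫ g) (by rw [← Category.assoc, hgg.1])
  obtain ⟨p, hfp, hap⟩ : ∃ p : P ⟶ Z', f₂ ≫ p = 0 ∧ a'' ≫ p = g' :=
    ⟨h.desc 0 g' (by rw [comp_zero, hg''.1]), h.inl_desc _ _ _, h.inr_desc _ _ _⟩
  have hp := isCoker_of_isPushout h hg' hfp hap
  refine ⟨Z', p, ?_⟩
  have hpp := isCoker_iff.1 hp
  have h0 := IsPushout.of_hasPushout a (f' ≫ b')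
  set i₀ := pushout.inl a (f' ≫ b')
  set v₀ := pushout.inr a (f' ≫ b')
  obtain ⟨m, hm1, hm2⟩ : ∃ m : P ⟶ _, f₂ ≫ m = i₀ ∧ a'' ≫ m = b' ≫ v₀ :=
    ⟨h.desc i₀ (b' ≫ v₀) (by rw [h0.w, Category.assoc]), h.inl_desc _ _ _, h.inr_desc _ _ _⟩
  obtain ⟨g₀, hg01, hg02⟩ : ∃ g₀ : _ ⟶ Z, i₀ ≫ g₀ = 0 ∧ v₀ ≫ g₀ = g :=
    ⟨h0.desc 0 g (by rw [comp_zero, hgg.1]), h0.inl_desc _ _ _, h0.inr_desc _ _ _⟩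
  have hi₀ := isKer_iff.1 ((hf _ _ _ h0).isKer (isCoker_of_isPushout h0 hg hg01 hg02))
  have hmg : m ≫ g₀ = p ≫ b := by
    apply h.hom_ext
    · rw [← Category.assoc, ← Category.assoc, hm1, hfp, hg01, zero_comp]
    · rw [← Category.assoc, ← Category.assoc, hm2, hap, Category.assoc, hg02, hb]
  have h1 := IsPushout.of_hasPushout (a ≫ f₂) (f' ≫ b')
  set j := pushout.inl (a ≫ f₂) (f' ≫ b')
  set v₁ := pushout.inr (a ≫ f₂) (f' ≫ b')
  obtain ⟨W, k, hk⟩ := hf _ _ _ h1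
  have hj := (isKer_iff.1 hk).2.1
  obtain ⟨n, hn1, hn2⟩ : ∃ n, i₀ ≫ n = f₂ ≫ j ∧ v₀ ≫ n = v₁ :=
    ⟨h0.desc (f₂ ≫ j) v₁ (by rw [← Category.assoc, h1.w]), h0.inl_desc _ _ _, h0.inr_desc _ _ _⟩
  obtain ⟨s, hs⟩ := hpp.2.2 (j - m ≫ n) (by
    rw [Preadditive.comp_sub, ← Category.assoc, hm1, hn1, sub_self])
  have hmono : Mono f₂ := by
    have := hi₀.2.1
    rw [← hm1] at this
    exact mono_of_mono f₂ m
  refine isKer_iff.2 ⟨hfp, hmono, fun t ht => ?_⟩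
  obtain ⟨x, hx⟩ := hi₀.2.2 (t ≫ m) (by
    rw [Category.assoc, hmg, ← Category.assoc, ht, zero_comp])
  refine ⟨x, (sub_eq_zero.1 ?_).symm⟩
  rw [← cancel_mono j, zero_comp]
  have e1 : (t - x ≫ f₂) ≫ m = 0 := by
    rw [Preadditive.sub_comp, Category.assoc, hm1, hx, sub_self]
  have e2 : (t - x ≫ f₂) ≫ p = 0 := by
    rw [Preadditive.sub_comp, Category.assoc, hfp, ht, comp_zero, sub_self]
  rw [sub_eq_iff_eq_add.1 hs.symm, Preadditive.comp_add, ← Category.assoc, e2, ← Category.assoc, e1,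
    zero_comp, zero_comp, zero_add]

theorem SemiStableCoker.of_comp [HasPullbacks C] [HasKernels C]
    {Y Y' Z : C} {b' : Y ⟶ Y'} {g' : Y' ⟶ Z}
    (hg : SemiStableCoker (b' ≫ g')) : SemiStableCoker g' := by
  intro Z' P a a'' g₂ h
  obtain ⟨X, f, hf⟩ := exists_isKer (b' ≫ g')
  obtain ⟨X', f', hf'⟩ := exists_isKer g'
  have hf'' := isKer_iff.1 hf'
  have hff := isKer_iff.1 hf
  obtain ⟨b, hb⟩ := hf''.2.2 (f ≫ b') (by rw [Category.assoc, hff.1])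
  obtain ⟨p, hgp, hap⟩ : ∃ p : X' ⟶ P, p ≫ g₂ = 0 ∧ p ≫ a'' = f' :=
    ⟨h.lift f' 0 (by rw [zero_comp, hf''.1]), h.lift_snd _ _ _, h.lift_fst _ _ _⟩
  have hp := isKer_of_isPullback h hf' hgp hap
  refine ⟨X', p, ?_⟩
  have hpp := isKer_iff.1 hp
  have h0 := IsPullback.of_hasPullback (b' ≫ g') a
  set i₀ := pullback.snd (b' ≫ g') a
  set v₀ := pullback.fst (b' ≫ g') a
  obtain ⟨m, hm1, hm2⟩ : ∃ m : _ ⟶ P, m ≫ g₂ = i₀ ∧ m ≫ a'' = v₀ ≫ b' :=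
    ⟨h.lift (v₀ ≫ b') i₀ (by rw [← h0.w, Category.assoc]), h.lift_snd _ _ _, h.lift_fst _ _ _⟩
  obtain ⟨f₀, hf01, hf02⟩ : ∃ f₀ : X ⟶ _, f₀ ≫ i₀ = 0 ∧ f₀ ≫ v₀ = f :=
    ⟨h0.lift f 0 (by rw [zero_comp, hff.1]), h0.lift_snd _ _ _, h0.lift_fst _ _ _⟩
  have hi₀ := isCoker_iff.1 ((hg _ _ _ h0).isCoker (isKer_of_isPullback h0 hf hf01 hf02))
  have hmf : f₀ ≫ m = b ≫ p := by
    apply h.hom_ext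
    · rw [Category.assoc, Category.assoc, hm2, hap, ← Category.assoc, hf02, hb]
    · rw [Category.assoc, Category.assoc, hm1, hgp, hf01, comp_zero]
  have h1 := IsPullback.of_hasPullback (b' ≫ g') (g₂ ≫ a)
  set j := pullback.snd (b' ≫ g') (g₂ ≫ a)
  set v₁ := pullback.fst (b' ≫ g') (g₂ ≫ a)
  obtain ⟨W, k, hk⟩ := hg _ _ _ h1
  have hj := (isCoker_iff.1 hk).2.1
  obtain ⟨n, hn1, hn2⟩ : ∃ n, n ≫ i₀ = j ≫ g₂ ∧ n ≫ v₀ = v₁ :=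
    ⟨h0.lift v₁ (j ≫ g₂) (by rw [Category.assoc, h1.w]), h0.lift_snd _ _ _, h0.lift_fst _ _ _⟩
  obtain ⟨s, hs⟩ := hpp.2.2 (j - n ≫ m) (by
    rw [Preadditive.sub_comp, Category.assoc, hm1, hn1, sub_self])
  have hepi : Epi g₂ := by
    have := hi₀.2.1
    rw [← hm1] at this
    exact epi_of_epi m g₂
  refine isCoker_iff.2 ⟨hgp, hepi, fun t ht => ?_⟩
  obtain ⟨x, hx⟩ := hi₀.2.2 (m ≫ t) (by
    rw [← Category.assoc, hmf, Category.assoc, ht, comp_zero])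
  refine ⟨x, (sub_eq_zero.1 ?_).symm⟩
  rw [← cancel_epi j, comp_zero]
  have e1 : m ≫ (t - g₂ ≫ x) = 0 := by
    rw [Preadditive.comp_sub, ← Category.assoc, hm1, hx, sub_self]
  have e2 : p ≫ (t - g₂ ≫ x) = 0 := by
    rw [Preadditive.comp_sub, ← Category.assoc, hgp, ht, zero_comp, sub_self]
  rw [sub_eq_iff_eq_add.1 hs.symm, Preadditive.add_comp, Category.assoc, e2, Category.assoc, e1,
    comp_zero, comp_zero, zero_add]

theorem SemiStableKer.comp [HasPushouts C] [HasCokernels C] {X Y Z : C} {f : X ⟶ Y} {f' : Y ⟶ Z}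
    (hf : SemiStableKer f) (hf' : SemiStableKer f') : SemiStableKer (f ≫ f') := by
  intro X' P a i v h
  have h0 := IsPushout.of_hasPushout a f
  set i₀ := pushout.inl a f
  set v₀ := pushout.inr a f
  obtain ⟨j, hj1, hj2⟩ : ∃ j, i₀ ≫ j = i ∧ v₀ ≫ j = f' ≫ v :=
    ⟨h0.desc i (f' ≫ v) (by rw [h.w, Category.assoc]), h0.inl_desc _ _ _, h0.inr_desc _ _ _⟩
  subst hj1
  have h1 : IsPushout v₀ f' j v := IsPushout.of_top h hj2 h0
  have hj : SemiStableKer j := hf'.of_isPushout h1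
  have hi := (hf.of_isPushout h0).isSomeKer
  obtain ⟨B, q, hq⟩ := exists_isCoker i₀
  have hi' := isKer_iff.1 (hi.isKer hq)
  have h2 := IsPushout.of_hasPushout q j
  set k := pushout.inl q j
  set c := pushout.inr q j
  obtain ⟨W, l, hl⟩ := hj _ _ _ h2
  have hk := (isKer_iff.1 hl).2.1
  obtain ⟨R, r, hr⟩ := exists_isCoker j
  have hjr := isKer_iff.1 (hj.isSomeKer.isKer hr)
  obtain ⟨d, hd1, hd2⟩ : ∃ d, k ≫ d = 0 ∧ c ≫ d = r :=
    ⟨h2.desc 0 r (by rw [comp_zero, hjr.1]), h2.inl_desc _ _ _, h2.inr_desc _ _ _⟩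
  refine ⟨_, c, isKer_iff.2 ⟨?_, ?_, fun t ht => ?_⟩⟩
  · rw [Category.assoc, ← h2.w, ← Category.assoc, hi'.1, zero_comp]
  · have := hi'.2.1
    have := hjr.2.1
    exact mono_comp _ _
  · obtain ⟨t', rfl⟩ := hjr.2.2 t (by rw [← hd2, ← Category.assoc, ht, zero_comp])
    obtain ⟨u, rfl⟩ := hi'.2.2 t' (by
      rw [← cancel_mono k, zero_comp, Category.assoc, h2.w, ← Category.assoc, ht])
    exact ⟨u, (Category.assoc _ _ _).symm⟩

theorem SemiStableCoker.comp [HasPullbacks C] [HasKernels C] {X Y Z : C} {g' : X ⟶ Y} {g : Y ⟶ Z}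
    (hg' : SemiStableCoker g') (hg : SemiStableCoker g) : SemiStableCoker (g' ≫ g) := by
  intro Z' P a v i h
  have h0 := IsPullback.of_hasPullback g a
  set i₀ := pullback.snd g a
  set v₀ := pullback.fst g a
  obtain ⟨j, hj1, hj2⟩ : ∃ j, j ≫ i₀ = i ∧ j ≫ v₀ = v ≫ g' :=
    ⟨h0.lift (v ≫ g') i (by rw [← h.w, Category.assoc]), h0.lift_snd _ _ _, h0.lift_fst _ _ _⟩
  subst hj1
  have h1 : IsPullback v j g' v₀ := (IsPullback.of_right h.flip hj2 h0.flip).flip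
  have hj : SemiStableCoker j := hg'.of_isPullback h1
  have hi := (hg.of_isPullback h0).isSomeCoker
  obtain ⟨B, q, hq⟩ := exists_isKer i₀
  have hi' := isCoker_iff.1 (hi.isCoker hq)
  have h2 := IsPullback.of_hasPullback j q
  set k := pullback.snd j q
  set c := pullback.fst j q
  obtain ⟨W, l, hl⟩ := hj _ _ _ h2
  have hk := (isCoker_iff.1 hl).2.1
  obtain ⟨R, r, hr⟩ := exists_isKer j
  have hjr := isCoker_iff.1 (hj.isSomeCoker.isCoker hr)
  obtain ⟨d, hd1, hd2⟩ : ∃ d, d ≫ k = 0 ∧ d ≫ c = r :=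
    ⟨h2.lift r 0 (by rw [zero_comp, hjr.1]), h2.lift_snd _ _ _, h2.lift_fst _ _ _⟩
  refine ⟨_, c, isCoker_iff.2 ⟨?_, ?_, fun t ht => ?_⟩⟩
  · rw [← Category.assoc, h2.w, Category.assoc, hi'.1, comp_zero]
  · have := hi'.2.1
    have := hjr.2.1
    exact epi_comp _ _
  · obtain ⟨t', rfl⟩ := hjr.2.2 t (by rw [← hd2, Category.assoc, ht, comp_zero])
    obtain ⟨u, rfl⟩ := hi'.2.2 t' (by
      rw [← cancel_epi k, comp_zero, ← Category.assoc, ← h2.w, Category.assoc, ht])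
    exact ⟨u, Category.assoc _ _ _⟩

theorem semiStableKer_of_isSplitMono {X Y : C} (f : X ⟶ Y) [IsSplitMono f] : SemiStableKer f := by
  intro X' P a i v h
  obtain ⟨r, hr1, -⟩ : ∃ r, i ≫ r = 𝟙 X' ∧ v ≫ r = retraction f ≫ a :=
    ⟨h.desc (𝟙 X') (retraction f ≫ a) (by simp), h.inl_desc _ _ _, h.inr_desc _ _ _⟩
  refine ⟨P, 𝟙 P - r ≫ i, isKer_iff.2 ⟨?_, ?_, fun t ht => ⟨t ≫ r, ?_⟩⟩⟩
  · rw [Preadditive.comp_sub, ← Category.assoc, hr1, Category.comp_id, Category.id_comp, sub_self]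
  · exact mono_of_mono_fac hr1
  · rw [Preadditive.comp_sub, Category.comp_id, sub_eq_zero] at ht
    rw [Category.assoc, ← ht]

theorem semiStableCoker_of_isSplitEpi {Y Z : C} (g : Y ⟶ Z) [IsSplitEpi g] :
    SemiStableCoker g := by
  intro Z' P b v p h
  obtain ⟨s, -, hs⟩ : ∃ s, s ≫ v = b ≫ section_ g ∧ s ≫ p = 𝟙 Z' :=
    ⟨h.lift (b ≫ section_ g) (𝟙 Z') (by simp), h.lift_fst _ _ _, h.lift_snd _ _ _⟩
  refine ⟨P, 𝟙 P - p ≫ s, isCoker_iff.2 ⟨?_, ?_, fun t ht => ⟨s ≫ t, ?_⟩⟩⟩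
  · rw [Preadditive.sub_comp, Category.assoc, hs, Category.comp_id, Category.id_comp, sub_self]
  · exact epi_of_epi_fac hs
  · rw [Preadditive.sub_comp, Category.id_comp, sub_eq_zero] at ht
    rw [← Category.assoc, ← ht]

section Biprod

variable [HasBinaryBiproducts C]

theorem isKer_inl_snd (X Z : C) :
    IsKer (biprod.inl : X ⟶ X ⊞ Z) (biprod.snd : X ⊞ Z ⟶ Z) :=
  isKer_iff.2 ⟨biprod.inl_snd, inferInstance, fun t ht => ⟨t ≫ biprod.fst, by
    apply biprod.hom_ext <;> simp [ht]⟩⟩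

theorem isCoker_inl_snd (X Z : C) :
    IsCoker (biprod.inl : X ⟶ X ⊞ Z) (biprod.snd : X ⊞ Z ⟶ Z) :=
  isCoker_iff.2 ⟨biprod.inl_snd, inferInstance, fun t ht => ⟨biprod.inr ≫ t, by
    apply biprod.hom_ext' <;> simp [ht]⟩⟩

theorem map_comp_desc {X Y X' Y' T : C} (a : X ⟶ X') (b : Y ⟶ Y') (c : X' ⟶ T) (d : Y' ⟶ T) :
    biprod.map a b ≫ biprod.desc c d = biprod.desc (a ≫ c) (b ≫ d) := by
  ext <;> simp

theorem isPushout_map_id {X Y : C} (f : X ⟶ Y) (W : C) :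
    IsPushout (biprod.inl : X ⟶ X ⊞ W) f (biprod.map f (𝟙 W)) biprod.inl :=
  ⟨⟨by simp⟩, ⟨PushoutCocone.IsColimit.mk _
    (fun s => biprod.desc s.inr (biprod.inr ≫ s.inl))
    (fun s => by ext <;> simp [s.condition]) (fun s => by simp)
    (fun s m h1 h2 => by ext <;> simp [← h1, ← h2])⟩⟩

theorem isPushout_id_map {X Y : C} (f : X ⟶ Y) (W : C) :
    IsPushout (biprod.inr : X ⟶ W ⊞ X) f (biprod.map (𝟙 W) f) biprod.inr :=
  ⟨⟨by simp⟩, ⟨PushoutCocone.IsColimit.mk _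
    (fun s => biprod.desc (biprod.inl ≫ s.inl) s.inr)
    (fun s => by ext <;> simp [s.condition]) (fun s => by simp)
    (fun s m h1 h2 => by ext <;> simp [← h1, ← h2])⟩⟩

theorem isPullback_map_id {Y Z : C} (g : Y ⟶ Z) (W : C) :
    IsPullback biprod.fst (biprod.map g (𝟙 W)) g (biprod.fst : Z ⊞ W ⟶ Z) :=
  ⟨⟨by simp⟩, ⟨PullbackCone.IsLimit.mk _
    (fun s => biprod.lift s.fst (s.snd ≫ biprod.snd))
    (fun s => by simp) (fun s => by ext <;> simp [s.condition])
    (fun s m h1 h2 => by ext <;> simp [← h1, ← h2])⟩⟩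

theorem isPullback_id_map {Y Z : C} (g : Y ⟶ Z) (W : C) :
    IsPullback biprod.snd (biprod.map (𝟙 W) g) g (biprod.snd : W ⊞ Z ⟶ Z) :=
  ⟨⟨by simp⟩, ⟨PullbackCone.IsLimit.mk _
    (fun s => biprod.lift (s.snd ≫ biprod.fst) s.fst)
    (fun s => by simp) (fun s => by ext <;> simp [s.condition])
    (fun s m h1 h2 => by ext <;> simp [← h1, ← h2])⟩⟩

theorem SemiStableKer.map [HasPushouts C] [HasCokernels C] {X Y X' Y' : C} {f : X ⟶ Y}
    {f' : X' ⟶ Y'} (hf : SemiStableKer f) (hf' : SemiStableKer f') :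
    SemiStableKer (biprod.map f f') := by
  have : biprod.map f f' = biprod.map f (𝟙 X') ≫ biprod.map (𝟙 Y) f' := by ext <;> simp
  rw [this]
  exact SemiStableKer.comp (hf.of_isPushout (isPushout_map_id f X'))
    (hf'.of_isPushout (isPushout_id_map f' Y))

theorem SemiStableCoker.map [HasPullbacks C] [HasKernels C] {X Y X' Y' : C} {f : X ⟶ Y}
    {f' : X' ⟶ Y'} (hf : SemiStableCoker f) (hf' : SemiStableCoker f') :
    SemiStableCoker (biprod.map f f') := by
  have : biprod.map f f' = biprod.map f (𝟙 X') ≫ biprod.map (𝟙 Y) f' := by ext <;> simp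
  rw [this]
  exact SemiStableCoker.comp (hf.of_isPullback (isPullback_map_id f X'))
    (hf'.of_isPullback (isPullback_id_map f' Y))

theorem isKer_map {X Y Z X' Y' Z' : C} {f : X ⟶ Y} {g : Y ⟶ Z} {f' : X' ⟶ Y'} {g' : Y' ⟶ Z'}
    (h : IsKer f g) (h' : IsKer f' g') : IsKer (biprod.map f f') (biprod.map g g') := by
  rw [isKer_iff] at h h' ⊢
  have := h.2.1
  have := h'.2.1
  refine ⟨by ext <;> simp [h.1, h'.1], ⟨fun a b hab => ?_⟩, fun t ht => ?_⟩
  · ext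
    · rw [← cancel_mono f]; simpa using hab =≫ biprod.fst
    · rw [← cancel_mono f']; simpa using hab =≫ biprod.snd
  · obtain ⟨x, hx⟩ := h.2.2 (t ≫ biprod.fst) (by simpa using ht =≫ biprod.fst)
    obtain ⟨y, hy⟩ := h'.2.2 (t ≫ biprod.snd) (by simpa using ht =≫ biprod.snd)
    exact ⟨biprod.lift x y, by ext <;> simp [hx, hy]⟩

theorem isCoker_map {X Y Z X' Y' Z' : C} {f : X ⟶ Y} {g : Y ⟶ Z} {f' : X' ⟶ Y'} {g' : Y' ⟶ Z'}
    (h : IsCoker f g) (h' : IsCoker f' g') : IsCoker (biprod.map f f') (biprod.map g g') := by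
  rw [isCoker_iff] at h h' ⊢
  have := h.2.1
  have := h'.2.1
  refine ⟨by ext <;> simp [h.1, h'.1], ⟨fun a b hab => ?_⟩, fun t ht => ?_⟩
  · ext
    · rw [← cancel_epi g]; simpa using biprod.inl ≫= hab
    · rw [← cancel_epi g']; simpa using biprod.inr ≫= hab
  · obtain ⟨x, hx⟩ := h.2.2 (biprod.inl ≫ t) (by simpa using biprod.inl ≫= ht)
    obtain ⟨y, hy⟩ := h'.2.2 (biprod.inr ≫ t) (by simpa using biprod.inr ≫= ht)
    exact ⟨biprod.desc x y, by ext <;> simp [hx, hy]⟩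

theorem exists_inverse {X Z P Q : C} {f₂ : X ⟶ P} {g₂ : P ⟶ Z} {f₃ : X ⟶ Q} {g₃ : Q ⟶ Z}
    (h₂ : IsKer f₂ g₂) (hg₂ : SemiStableCoker g₂) (h₃ : IsKer f₃ g₃) (φ : P ⟶ Q)
    (hf : f₂ ≫ φ = f₃) (hg : φ ≫ g₃ = g₂) :
    ∃ ψ : Q ⟶ P, φ ≫ ψ = 𝟙 P ∧ ψ ≫ φ = 𝟙 Q := by
  rw [isKer_iff] at h₂ h₃
  have := h₃.2.1
  have hP : IsPullback (biprod.snd : X ⊞ P ⟶ P) (biprod.desc f₃ φ) g₂ g₃ := by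
    have key : ∀ s : PullbackCone g₂ g₃, ∃ x, x ≫ f₃ = s.snd - s.fst ≫ φ := fun s =>
      h₃.2.2 _ (by rw [Preadditive.sub_comp, Category.assoc, hg, s.condition, sub_self])
    choose x hx using key
    refine ⟨⟨by ext <;> simp [h₃.1, hg]⟩, ⟨PullbackCone.IsLimit.mk _
      (fun s => biprod.lift (x s) s.fst) (fun s => by simp) (fun s => by simp [hx])
      (fun s m h1 h2 => ?_)⟩⟩
    ext
    · rw [← cancel_mono f₃, biprod.lift_fst, hx, ← h1, ← h2, Category.assoc, Category.assoc,
        ← Preadditive.comp_sub]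
      congr 1
      ext <;> simp
    · simpa using h1
  obtain ⟨W, k, hk⟩ := hg₂ _ _ _ hP
  rw [isCoker_iff] at hk
  have hk1 : (k ≫ biprod.fst) ≫ f₃ + (k ≫ biprod.snd) ≫ φ = 0 := by
    rw [← hk.1, biprod.desc_eq]; simp
  obtain ⟨y, hy⟩ := h₂.2.2 (k ≫ biprod.snd) (by
    have := hk1 =≫ g₃
    simpa [h₃.1, hg] using this)
  have hy' : k ≫ biprod.fst = - y := by
    rw [← cancel_mono f₃, Preadditive.neg_comp, eq_neg_iff_add_eq_zero, ← hf,
      ← Category.assoc y, hy, hf, hk1]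
  obtain ⟨ψ, hψ⟩ := hk.2.2 (biprod.desc f₂ (𝟙 P)) (by
    rw [biprod.desc_eq, Preadditive.comp_add, ← Category.assoc, hy', ← Category.assoc, ← hy]
    simp)
  have e1 : f₃ ≫ ψ = f₂ := by simpa using biprod.inl ≫= hψ
  have e2 : φ ≫ ψ = 𝟙 P := by simpa using biprod.inr ≫= hψ
  refine ⟨ψ, e2, ?_⟩
  have := hk.2.1
  rw [← cancel_epi (biprod.desc f₃ φ)]
  ext
  · simp [reassoc_of% e1, hf]
  · simp [reassoc_of% e2]

end Biprod
end Stability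
end SemiAb

namespace SemiAb

section Ext

variable {C : Type u} [Category.{v} C] [Preadditive C]

/-- A complex `X ⟶ Y ⟶ Z` with prescribed end-terms `X` and `Z`. -/
structure Cplx (X Z : C) where
  Y : C
  f : X ⟶ Y
  g : Y ⟶ Z
  w : f ≫ g = 0

namespace Cplx

/-- `X ⟶ Y ⟶ Z` is short exact: `f` is a kernel of `g` and `g` is a cokernel of `f`. -/
def IsShortExact {X Z : C} (ξ : Cplx X Z) : Prop := IsKer ξ.f ξ.g ∧ IsCoker ξ.f ξ.g

/-- Isomorphism of complexes which is the identity on both end-terms. -/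
def Equivalent {X Z : C} (ξ η : Cplx X Z) : Prop :=
  ∃ e : ξ.Y ≅ η.Y, ξ.f ≫ e.hom = η.f ∧ e.hom ≫ η.g = ξ.g

/-- There is a morphism of complexes `(a, v, b) : ξ ⟶ η` for some `v`. -/
def HasMap {X Z X' Z' : C} (a : X ⟶ X') (b : Z ⟶ Z') (ξ : Cplx X Z) (η : Cplx X' Z') : Prop :=
  ∃ v : ξ.Y ⟶ η.Y, ξ.f ≫ v = a ≫ η.f ∧ v ≫ η.g = ξ.g ≫ b

theorem HasMap.comp {X Z X' Z' X'' Z'' : C} {a : X ⟶ X'} {b : Z ⟶ Z'} {a' : X' ⟶ X''}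
    {b' : Z' ⟶ Z''} {ξ : Cplx X Z} {η : Cplx X' Z'} {ζ : Cplx X'' Z''} (h : HasMap a b ξ η)
    (h' : HasMap a' b' η ζ) : HasMap (a ≫ a') (b ≫ b') ξ ζ := by
  obtain ⟨v, h1, h2⟩ := h
  obtain ⟨v', h1', h2'⟩ := h'
  exact ⟨v ≫ v', by rw [reassoc_of% h1, h1', Category.assoc],
    by rw [Category.assoc, h2', reassoc_of% h2]⟩

theorem HasMap.refl {X Z : C} (ξ : Cplx X Z) : HasMap (𝟙 X) (𝟙 Z) ξ ξ :=
  ⟨𝟙 _, by simp, by simp⟩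

theorem Equivalent.hasMap {X Z : C} {ξ η : Cplx X Z} (h : Equivalent ξ η) :
    HasMap (𝟙 X) (𝟙 Z) ξ η := by
  obtain ⟨e, h1, h2⟩ := h
  exact ⟨e.hom, by simp [h1], by simp [h2]⟩

variable [Preabelian C]

/-- The complex `a ξ`: push out `f` along `a : X ⟶ X'`. -/
noncomputable def push {X X' Z : C} (a : X ⟶ X') (ξ : Cplx X Z) : Cplx X' Z where
  Y := pushout a ξ.f
  f := pushout.inl a ξ.f
  g := pushout.desc 0 ξ.g (by rw [comp_zero, ξ.w])
  w := pushout.inl_desc _ _ _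

/-- The complex `ξ b`: pull back `g` along `b : Z' ⟶ Z`. -/
noncomputable def pull {X Z' Z : C} (ξ : Cplx X Z) (b : Z' ⟶ Z) : Cplx X Z' where
  Y := pullback ξ.g b
  f := pullback.lift ξ.f 0 (by rw [zero_comp, ξ.w])
  g := pullback.snd ξ.g b
  w := pullback.lift_snd _ _ _

/-- The direct sum `ξ ⊕ ξ'`. -/
noncomputable def dsum {X Z X' Z' : C} (ξ : Cplx X Z) (ξ' : Cplx X' Z') :
    Cplx (X ⊞ X') (Z ⊞ Z') where
  Y := ξ.Y ⊞ ξ'.Y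
  f := biprod.map ξ.f ξ'.f
  g := biprod.map ξ.g ξ'.g
  w := by ext <;> simp [ξ.w, ξ'.w]

/-- The split complex `X ⟶ X ⊕ Z ⟶ Z`. -/
noncomputable def split (X Z : C) : Cplx X Z where
  Y := X ⊞ Z
  f := biprod.inl
  g := biprod.snd
  w := biprod.inl_snd

/-- A short exact sequence `ξ` is stable if all `a ξ` and all `ξ b` are short exact. -/
structure IsStable {X Z : C} (ξ : Cplx X Z) : Prop where
  shortExact : ξ.IsShortExact
  push : ∀ {X' : C} (a : X ⟶ X'), (ξ.push a).IsShortExact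
  pull : ∀ {Z' : C} (b : Z' ⟶ Z), (ξ.pull b).IsShortExact

theorem push_spec {X X' Z : C} (a : X ⟶ X') (ξ : Cplx X Z) :
    ∃ v : ξ.Y ⟶ (ξ.push a).Y, IsPushout a ξ.f (ξ.push a).f v ∧ v ≫ (ξ.push a).g = ξ.g :=
  ⟨pushout.inr a ξ.f, IsPushout.of_hasPushout a ξ.f, pushout.inr_desc _ _ _⟩

theorem pull_spec {X Z' Z : C} (ξ : Cplx X Z) (b : Z' ⟶ Z) :
    ∃ v : (ξ.pull b).Y ⟶ ξ.Y, IsPullback v (ξ.pull b).g ξ.g b ∧ (ξ.pull b).f ≫ v = ξ.f :=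
  ⟨pullback.fst ξ.g b, IsPullback.of_hasPullback ξ.g b, pullback.lift_fst _ _ _⟩

theorem isStable_iff {X Z : C} {ξ : Cplx X Z} :
    ξ.IsStable ↔ ξ.IsShortExact ∧ SemiStableKer ξ.f ∧ SemiStableCoker ξ.g := by
  constructor
  · intro h
    refine ⟨h.shortExact, fun X' P a i v hp => ?_, fun Z' P b v p hp => ?_⟩
    · obtain ⟨w, m, hm'⟩ := isKer_iff.1 (h.push a).1
      obtain ⟨v', h0, -⟩ := ξ.push_spec a
      let e := h0.isoIsPushout _ _ hp
      have he : (ξ.push a).f ≫ e.hom = i := IsPushout.inl_isoIsPushout_hom _ _ _ _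
      have hi : i ≫ e.inv = (ξ.push a).f := by rw [← he]; simp
      refine ⟨Z, e.inv ≫ (ξ.push a).g, isKer_iff.2 ⟨by rw [reassoc_of% hi, w], ?_, fun t ht => ?_⟩⟩
      · exact mono_of_mono_fac hi
      · obtain ⟨u, hu⟩ := hm' (t ≫ e.inv) (by rw [Category.assoc, ht])
        exact ⟨u, by rw [← cancel_mono e.inv, Category.assoc, hi, hu]⟩
    · obtain ⟨w, m, hm'⟩ := isCoker_iff.1 (h.pull b).2
      obtain ⟨v', h0, -⟩ := ξ.pull_spec b
      let e := h0.isoIsPullback _ _ hp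
      have hi : e.hom ≫ p = (ξ.pull b).g := IsPullback.isoIsPullback_hom_snd _ _ _ _
      refine ⟨X, (ξ.pull b).f ≫ e.hom, isCoker_iff.2 ⟨by rw [Category.assoc, hi, w], ?_,
        fun t ht => ?_⟩⟩
      · exact epi_of_epi_fac hi
      · obtain ⟨u, hu⟩ := hm' (e.hom ≫ t) (by rw [← Category.assoc, ht])
        exact ⟨u, by rw [← cancel_epi e.hom, ← Category.assoc, hi, hu]⟩
  · rintro ⟨hs, hf, hg⟩
    refine ⟨hs, fun a => ?_, fun b => ?_⟩
    · obtain ⟨v, hp, hv⟩ := ξ.push_spec a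
      have hc : IsCoker (ξ.push a).f (ξ.push a).g :=
        isCoker_of_isPushout hp hs.2 (ξ.push a).w hv
      exact ⟨(hf _ _ _ hp).isKer hc, hc⟩
    · obtain ⟨v, hp, hv⟩ := ξ.pull_spec b
      have hk : IsKer (ξ.pull b).f (ξ.pull b).g :=
        isKer_of_isPullback hp hs.1 (ξ.pull b).w hv
      exact ⟨hk, (hg _ _ _ hp).isCoker hk⟩

theorem IsStable.pushStable {X X' Z : C} {ξ : Cplx X Z} (h : ξ.IsStable) (a : X ⟶ X') :
    (ξ.push a).IsStable := by
  have h' := isStable_iff.1 h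
  obtain ⟨v, hp, hv⟩ := ξ.push_spec a
  exact isStable_iff.2 ⟨h.push a, h'.2.1.of_isPushout hp,
    SemiStableCoker.of_comp (b' := v) (by rw [hv]; exact h'.2.2)⟩

theorem IsStable.pullStable {X Z' Z : C} {ξ : Cplx X Z} (h : ξ.IsStable) (b : Z' ⟶ Z) :
    (ξ.pull b).IsStable := by
  have h' := isStable_iff.1 h
  obtain ⟨v, hp, hv⟩ := ξ.pull_spec b
  exact isStable_iff.2 ⟨h.pull b, SemiStableKer.of_comp (b' := v) (by rw [hv]; exact h'.2.1),
    h'.2.2.of_isPullback hp⟩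

theorem IsStable.dsumStable {X Z X' Z' : C} {ξ : Cplx X Z} {ξ' : Cplx X' Z'} (h : ξ.IsStable)
    (h' : ξ'.IsStable) : (ξ.dsum ξ').IsStable := by
  rw [isStable_iff] at h h' ⊢
  exact ⟨⟨isKer_map h.1.1 h'.1.1, isCoker_map h.1.2 h'.1.2⟩, h.2.1.map h'.2.1, h.2.2.map h'.2.2⟩

theorem split_isStable (X Z : C) : (split X Z).IsStable :=
  isStable_iff.2 ⟨⟨isKer_inl_snd X Z, isCoker_inl_snd X Z⟩,
    semiStableKer_of_isSplitMono (biprod.inl : X ⟶ X ⊞ Z),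
    semiStableCoker_of_isSplitEpi (biprod.snd : X ⊞ Z ⟶ Z)⟩

theorem hasMap_push {X X' Z : C} (a : X ⟶ X') (ξ : Cplx X Z) : HasMap a (𝟙 Z) ξ (ξ.push a) := by
  obtain ⟨v, hp, hv⟩ := ξ.push_spec a
  exact ⟨v, hp.w.symm, by rw [hv, Category.comp_id]⟩

theorem pull_hasMap {X Z' Z : C} (ξ : Cplx X Z) (b : Z' ⟶ Z) : HasMap (𝟙 X) b (ξ.pull b) ξ := by
  obtain ⟨v, hp, hv⟩ := ξ.pull_spec b
  exact ⟨v, by rw [hv, Category.id_comp], hp.w⟩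

theorem HasMap.of_push {X Z X' X'' Z'' : C} {a : X ⟶ X'} {a' : X' ⟶ X''} {b : Z ⟶ Z''}
    {ξ : Cplx X Z} {η : Cplx X'' Z''} (h : HasMap (a ≫ a') b ξ η) :
    HasMap a' b (ξ.push a) η := by
  obtain ⟨v, h1, h2⟩ := h
  obtain ⟨v', hp, hv⟩ := ξ.push_spec a
  have hw : a ≫ a' ≫ η.f = ξ.f ≫ v := by rw [h1, Category.assoc]
  refine ⟨hp.desc (a' ≫ η.f) v hw, hp.inl_desc _ _ _, hp.hom_ext ?_ ?_⟩
  · rw [hp.inl_desc_assoc, Category.assoc, η.w, comp_zero, ← Category.assoc, (ξ.push a).w,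
      zero_comp]
  · rw [hp.inr_desc_assoc, h2, reassoc_of% hv]

theorem HasMap.to_pull {X Z X' Z' Z'' : C} {a : X ⟶ X'} {b : Z ⟶ Z'} {b' : Z' ⟶ Z''}
    {ξ : Cplx X Z} {η : Cplx X' Z''} (h : HasMap a (b ≫ b') ξ η) :
    HasMap a b ξ (η.pull b') := by
  obtain ⟨v, h1, h2⟩ := h
  obtain ⟨v', hp, hv⟩ := η.pull_spec b'
  have hw : v ≫ η.g = (ξ.g ≫ b) ≫ b' := by rw [h2, Category.assoc]
  refine ⟨hp.lift v (ξ.g ≫ b) hw, hp.hom_ext ?_ ?_, hp.lift_snd _ _ _⟩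
  · rw [Category.assoc, hp.lift_fst, h1, Category.assoc, hv]
  · rw [Category.assoc, hp.lift_snd, Category.assoc, (η.pull b').w, comp_zero, ← Category.assoc,
      ξ.w, zero_comp]

theorem HasMap.equivalent {X Z : C} {ξ η : Cplx X Z} (hξ : ξ.IsStable) (hη : η.IsStable)
    (h : HasMap (𝟙 X) (𝟙 Z) ξ η) : Equivalent ξ η := by
  obtain ⟨φ, h1, h2⟩ := h
  rw [Category.id_comp] at h1
  rw [Category.comp_id] at h2
  obtain ⟨ψ, e1, e2⟩ := exists_inverse hξ.shortExact.1 (isStable_iff.1 hξ).2.2 hη.shortExact.1 φ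
    h1 h2
  exact ⟨⟨φ, ψ, e1, e2⟩, h1, h2⟩

end Cplx

variable [Preabelian C]

/-- Equivalence of stable exact sequences with end-terms `X` and `Z`. -/
def stableSetoid (Z X : C) : Setoid {ξ : Cplx X Z // ξ.IsStable} where
  r ξ η := Cplx.Equivalent ξ.1 η.1
  iseqv :=
    ⟨fun ξ => ⟨Iso.refl _, Category.comp_id _, Category.id_comp _⟩,
      fun ⟨e, h1, h2⟩ => ⟨e.symm, by simp [← h1], by simp [← h2]⟩,
      fun ⟨e, h1, h2⟩ ⟨e', h1', h2'⟩ => ⟨e ≪≫ e', by simp [reassoc_of% h1, h1'],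
        by simp [h2', h2]⟩⟩

/-- `Ext¹(Z, X)`: equivalence classes of stable exact sequences `X ⟶ Y ⟶ Z`. -/
def Ext1 (Z X : C) : Type (max u v) := Quotient (stableSetoid Z X)

namespace Ext1

/-- The class of a stable exact sequence. -/
def mk {Z X : C} (ξ : Cplx X Z) (h : ξ.IsStable) : Ext1 Z X :=
  Quotient.mk (stableSetoid Z X) ⟨ξ, h⟩

theorem ind {Z X : C} {p : Ext1 Z X → Prop} (h : ∀ ξ hξ, p (mk ξ hξ)) (x : Ext1 Z X) : p x :=
  Quotient.ind (fun ξ => h ξ.1 ξ.2) x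

theorem mk_eq {Z X : C} {ξ η : Cplx X Z} {hξ : ξ.IsStable} {hη : η.IsStable}
    (h : Cplx.HasMap (𝟙 X) (𝟙 Z) ξ η) : mk ξ hξ = mk η hη :=
  Quotient.sound (h.equivalent hξ hη)

/-- `ξ ↦ a ξ`. -/
noncomputable def push {Z X X' : C} (a : X ⟶ X') : Ext1 Z X → Ext1 Z X' :=
  Quotient.lift (fun ξ => mk (ξ.1.push a) (ξ.2.pushStable a)) fun _ η h => mk_eq
    (.of_push (by simpa using (Cplx.Equivalent.hasMap h).comp (η.1.hasMap_push a)))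

/-- `ξ ↦ ξ b`. -/
noncomputable def pull {Z' Z X : C} (b : Z' ⟶ Z) : Ext1 Z X → Ext1 Z' X :=
  Quotient.lift (fun ξ => mk (ξ.1.pull b) (ξ.2.pullStable b)) fun ξ _ h => mk_eq
    (.to_pull (by simpa using (ξ.1.pull_hasMap b).comp (Cplx.Equivalent.hasMap h)))

theorem dsum_hasMap {X Z X' Z' X₁ Z₁ X₁' Z₁' : C} {ξ : Cplx X Z} {ξ' : Cplx X' Z'}
    {η : Cplx X₁ Z₁} {η' : Cplx X₁' Z₁'} {a : X ⟶ X₁} {b : Z ⟶ Z₁} {a' : X' ⟶ X₁'}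
    {b' : Z' ⟶ Z₁'} (h : Cplx.HasMap a b ξ η) (h' : Cplx.HasMap a' b' ξ' η') :
    Cplx.HasMap (biprod.map a a') (biprod.map b b') (ξ.dsum ξ') (η.dsum η') := by
  obtain ⟨v, h1, h2⟩ := h
  obtain ⟨v', h1', h2'⟩ := h'
  exact ⟨biprod.map v v', by simp only [Cplx.dsum]; ext <;> simp [h1, h1'],
    by simp only [Cplx.dsum]; ext <;> simp [h2, h2']⟩

theorem map_id_id (A B : C) : biprod.map (𝟙 A) (𝟙 B) = 𝟙 (A ⊞ B) := by ext <;> simp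

/-- `(ξ, ξ') ↦ ξ ⊕ ξ'`. -/
noncomputable def dsum {Z X Z' X' : C} : Ext1 Z X → Ext1 Z' X' → Ext1 (Z ⊞ Z') (X ⊞ X') :=
  Quotient.lift₂ (fun ξ ξ' => mk (ξ.1.dsum ξ'.1) (ξ.2.dsumStable ξ'.2)) fun _ _ _ _ h h' => mk_eq
    (by simpa only [map_id_id] using dsum_hasMap (Cplx.Equivalent.hasMap h) (Cplx.Equivalent.hasMap h'))

theorem push_mk_eq_pull_mk {Z X Z' X' : C} {ξ : Cplx X Z} {η : Cplx X' Z'} (hξ : ξ.IsStable)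
    (hη : η.IsStable) {a : X ⟶ X'} {b : Z ⟶ Z'} (h : Cplx.HasMap a b ξ η) :
    push a (mk ξ hξ) = pull b (mk η hη) :=
  mk_eq (.of_push (.to_pull (by simpa using h)))

theorem pull_id {Z X : C} (x : Ext1 Z X) : pull (𝟙 Z) x = x := by
  induction x using ind with | h ξ hξ =>
  exact mk_eq (ξ.pull_hasMap (𝟙 Z))

theorem push_id {Z X : C} (x : Ext1 Z X) : push (𝟙 X) x = x := by
  induction x using ind with | h ξ hξ =>
  exact (mk_eq (ξ.hasMap_push (𝟙 X))).symm

theorem push_mk_eq {Z X X' : C} {ξ : Cplx X Z} {η : Cplx X' Z} (hξ : ξ.IsStable)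
    (hη : η.IsStable) {a : X ⟶ X'} (h : Cplx.HasMap a (𝟙 Z) ξ η) : push a (mk ξ hξ) = mk η hη := by
  rw [push_mk_eq_pull_mk hξ hη h, pull_id]

theorem pull_mk_eq {Z Z' X : C} {ξ : Cplx X Z} {η : Cplx X Z'} (hξ : ξ.IsStable)
    (hη : η.IsStable) {b : Z ⟶ Z'} (h : Cplx.HasMap (𝟙 X) b ξ η) : pull b (mk η hη) = mk ξ hξ := by
  rw [← push_mk_eq_pull_mk hξ hη h, push_id]

theorem push_comp {Z X X' X'' : C} (a : X ⟶ X') (a' : X' ⟶ X'') (x : Ext1 Z X) :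
    push (a ≫ a') x = push a' (push a x) := by
  induction x using ind with | h ξ hξ =>
  exact push_mk_eq _ _ (by simpa using (ξ.hasMap_push a).comp ((ξ.push a).hasMap_push a'))

theorem pull_comp {Z'' Z' Z X : C} (b' : Z'' ⟶ Z') (b : Z' ⟶ Z) (x : Ext1 Z X) :
    pull (b' ≫ b) x = pull b' (pull b x) := by
  induction x using ind with | h ξ hξ =>
  exact pull_mk_eq _ _ (by simpa using ((ξ.pull b).pull_hasMap b').comp (ξ.pull_hasMap b))

theorem push_pull {Z' Z X X' : C} (a : X ⟶ X') (b : Z' ⟶ Z) (x : Ext1 Z X) :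
    push a (pull b x) = pull b (push a x) := by
  induction x using ind with | h ξ hξ =>
  exact push_mk_eq_pull_mk _ _ (by simpa using (ξ.pull_hasMap b).comp (ξ.hasMap_push a))

theorem push_map_dsum {Z Z' X X' X₁ X₁' : C} (a : X ⟶ X₁) (a' : X' ⟶ X₁') (x : Ext1 Z X)
    (y : Ext1 Z' X') : push (biprod.map a a') (dsum x y) = dsum (push a x) (push a' y) := by
  induction x using ind with | h ξ hξ =>
  induction y using ind with | h η hη =>
  exact push_mk_eq _ _ (by simpa only [map_id_id] using dsum_hasMap (ξ.hasMap_push a) (η.hasMap_push a'))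

theorem pull_map_dsum {Z Z' X X' Z₁ Z₁' : C} (b : Z₁ ⟶ Z) (b' : Z₁' ⟶ Z') (x : Ext1 Z X)
    (y : Ext1 Z' X') : pull (biprod.map b b') (dsum x y) = dsum (pull b x) (pull b' y) := by
  induction x using ind with | h ξ hξ =>
  induction y using ind with | h η hη =>
  exact pull_mk_eq _ _ (by simpa only [map_id_id] using dsum_hasMap (ξ.pull_hasMap b) (η.pull_hasMap b'))

/-- The diagonal `Δ : A ⟶ A ⊕ A`. -/
noncomputable abbrev diag (A : C) : A ⟶ A ⊞ A := biprod.lift (𝟙 A) (𝟙 A)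

/-- The codiagonal `∇ : A ⊕ A ⟶ A`. -/
noncomputable abbrev codiag (A : C) : A ⊞ A ⟶ A := biprod.desc (𝟙 A) (𝟙 A)

theorem push_diag {Z X : C} (x : Ext1 Z X) : push (diag X) x = pull (diag Z) (dsum x x) := by
  induction x using ind with | h ξ hξ =>
  exact push_mk_eq_pull_mk _ _
    ⟨diag ξ.Y, by simp only [Cplx.dsum]; ext <;> simp, by simp only [Cplx.dsum]; ext <;> simp⟩

theorem push_codiag {Z X : C} (x : Ext1 Z X) :
    push (codiag X) (dsum x x) = pull (codiag Z) x := by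
  induction x using ind with | h ξ hξ =>
  exact push_mk_eq_pull_mk _ _
    ⟨codiag ξ.Y, by simp only [Cplx.dsum]; ext <;> simp, by simp only [Cplx.dsum]; ext <;> simp⟩

theorem push_braid {Z Z' X X' : C} (x : Ext1 Z X) (y : Ext1 Z' X') :
    push (biprod.braiding X X').hom (dsum x y) = pull (biprod.braiding Z Z').hom (dsum y x) := by
  induction x using ind with | h ξ hξ =>
  induction y using ind with | h η hη =>
  exact push_mk_eq_pull_mk _ _
    ⟨(biprod.braiding ξ.Y η.Y).hom, by simp only [Cplx.dsum]; ext <;> simp,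
      by simp only [Cplx.dsum]; ext <;> simp⟩

theorem push_assoc {Z Z' Z'' X X' X'' : C} (x : Ext1 Z X) (y : Ext1 Z' X') (z : Ext1 Z'' X'') :
    push (biprod.associator X X' X'').hom (dsum (dsum x y) z) =
      pull (biprod.associator Z Z' Z'').hom (dsum x (dsum y z)) := by
  induction x using ind with | h ξ hξ =>
  induction y using ind with | h η hη =>
  induction z using ind with | h ζ hζ =>
  exact push_mk_eq_pull_mk _ _
    ⟨(biprod.associator ξ.Y η.Y ζ.Y).hom, by simp only [Cplx.dsum]; ext <;> simp,
      by simp only [Cplx.dsum]; ext <;> simp⟩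

/-- The zero of `Ext¹(Z, X)` is the class of the split sequence. -/
noncomputable instance (Z X : C) : Zero (Ext1 Z X) :=
  ⟨mk (Cplx.split X Z) (Cplx.split_isStable X Z)⟩

/-- The Baer sum `ξ + ξ' = ∇ (ξ ⊕ ξ') Δ`. -/
noncomputable instance (Z X : C) : Add (Ext1 Z X) :=
  ⟨fun x y => pull (diag Z) (push (codiag X) (dsum x y))⟩

/-- The inverse of `ξ` is `(-1) ξ`. -/
noncomputable instance (Z X : C) : Neg (Ext1 Z X) := ⟨push (-𝟙 X)⟩

theorem add_def {Z X : C} (x y : Ext1 Z X) :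
    x + y = pull (diag Z) (push (codiag X) (dsum x y)) := rfl

theorem push_add {Z X X' : C} (a : X ⟶ X') (x y : Ext1 Z X) :
    push a (x + y) = push a x + push a y := by
  rw [add_def, add_def, push_pull, ← push_comp, ← push_map_dsum, ← push_comp]
  congr 2
  ext <;> simp

theorem pull_add {Z' Z X : C} (b : Z' ⟶ Z) (x y : Ext1 Z X) :
    pull b (x + y) = pull b x + pull b y := by
  rw [add_def, add_def, ← pull_comp, ← pull_map_dsum, push_pull, ← pull_comp]
  congr 1
  ext <;> simp

theorem add_push {Z X X' : C} (a b : X ⟶ X') (x : Ext1 Z X) :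
    push (a + b) x = push a x + push b x := by
  rw [add_def, ← push_map_dsum, ← push_comp, ← push_pull, ← push_diag, ← push_comp]
  congr 1
  rw [map_comp_desc, biprod.lift_desc]; simp

theorem add_pull {Z' Z X : C} (a b : Z' ⟶ Z) (x : Ext1 Z X) :
    pull (a + b) x = pull a x + pull b x := by
  rw [add_def, ← pull_map_dsum, push_pull, push_codiag, ← pull_comp, ← pull_comp]
  congr 1
  rw [Category.assoc, map_comp_desc, biprod.lift_desc]; simp

theorem push_zero {Z X X' : C} (x : Ext1 Z X) : push (0 : X ⟶ X') x = 0 := by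
  induction x using ind with | h ξ hξ =>
  have h1 : ξ.f ≫ ξ.g ≫ (biprod.inr : Z ⟶ X' ⊞ Z) = (0 : X ⟶ X') ≫ biprod.inl := by
    rw [← Category.assoc, ξ.w, zero_comp, zero_comp]
  have h2 : (ξ.g ≫ (biprod.inr : Z ⟶ X' ⊞ Z)) ≫ biprod.snd = ξ.g ≫ 𝟙 Z := by simp
  exact push_mk_eq _ _ ⟨_, h1, h2⟩

theorem pull_zero {Z' Z X : C} (x : Ext1 Z X) : pull (0 : Z' ⟶ Z) x = 0 := by
  induction x using ind with | h ξ hξ =>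
  have h1 : biprod.inl ≫ (biprod.fst : X ⊞ Z' ⟶ X) ≫ ξ.f = 𝟙 X ≫ ξ.f := by simp
  have h2 : ((biprod.fst : X ⊞ Z' ⟶ X) ≫ ξ.f) ≫ ξ.g = biprod.snd ≫ (0 : Z' ⟶ Z) := by
    rw [Category.assoc, ξ.w, comp_zero, comp_zero]
  exact pull_mk_eq _ _ ⟨_, h1, h2⟩

theorem add_comm' {Z X : C} (x y : Ext1 Z X) : x + y = y + x := by
  have h1 : codiag X = (biprod.braiding X X).hom ≫ codiag X := by ext <;> simp
  have h2 : diag Z = diag Z ≫ (biprod.braiding Z Z).hom := by ext <;> simp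
  rw [add_def, h1, push_comp, push_braid, push_pull, ← pull_comp, ← h2, add_def]

theorem add_assoc' {Z X : C} (x y z : Ext1 Z X) : x + y + z = x + (y + z) := by
  have e1 : dsum (x + y) z = pull (biprod.map (diag Z) (𝟙 Z))
      (push (biprod.map (codiag X) (𝟙 X)) (dsum (dsum x y) z)) := by
    rw [push_map_dsum, pull_map_dsum, push_id, pull_id, add_def]
  have e2 : dsum x (y + z) = pull (biprod.map (𝟙 Z) (diag Z))
      (push (biprod.map (𝟙 X) (codiag X)) (dsum x (dsum y z))) := by
    rw [push_map_dsum, pull_map_dsum, push_id, pull_id, add_def]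
  have h1 : biprod.map (codiag X) (𝟙 X) ≫ codiag X =
      (biprod.associator X X X).hom ≫ biprod.map (𝟙 X) (codiag X) ≫ codiag X := by
    rw [biprod.associator_hom, map_comp_desc, map_comp_desc, biprod.lift_desc]
    ext <;> simp [biprod.lift_desc]
  have h2 : diag Z ≫ biprod.map (diag Z) (𝟙 Z) ≫ (biprod.associator Z Z Z).hom =
      diag Z ≫ biprod.map (𝟙 Z) (diag Z) := by
    ext <;> simp
  rw [add_def (x + y), e1, add_def x, e2, push_pull, push_pull, ← push_comp, ← push_comp,
    ← pull_comp, ← pull_comp, h1, push_comp, push_assoc, push_pull, ← pull_comp, Category.assoc, h2]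

/-- `Ext¹(Z, X)` is an abelian group under the Baer sum. -/
noncomputable instance (Z X : C) : AddCommGroup (Ext1 Z X) where
  add_assoc := add_assoc'
  zero_add x := by
    have := add_push 0 (𝟙 X) x
    rwa [push_zero, push_id, zero_add, push_id, eq_comm] at this
  add_zero x := by
    have := add_push (𝟙 X) 0 x
    rwa [push_zero, push_id, add_zero, push_id, eq_comm] at this
  nsmul := nsmulRec
  zsmul := zsmulRec
  neg_add_cancel x := by
    have := add_push (-𝟙 X) (𝟙 X) x
    rw [push_id, neg_add_cancel, push_zero] at this
    exact this.symm
  add_comm := add_comm'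

end Ext1

/-- The covariant functor `Ext¹(Z, -)`. -/
noncomputable def ext1Covariant (Z : C) : C ⥤ Ab.{max u v} where
  obj X := AddCommGrpCat.of (Ext1 Z X)
  map a := AddCommGrpCat.ofHom (AddMonoidHom.mk' (Ext1.push a) (Ext1.push_add a))
  map_id X := by ext x; exact Ext1.push_id x
  map_comp a a' := by ext x; exact Ext1.push_comp a a' x

/-- The contravariant functor `Ext¹(-, X)`. -/
noncomputable def ext1Contravariant (X : C) : Cᵒᵖ ⥤ Ab.{max u v} where
  obj Z := AddCommGrpCat.of (Ext1 Z.unop X)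
  map b := AddCommGrpCat.ofHom (AddMonoidHom.mk' (Ext1.pull b.unop) (Ext1.pull_add b.unop))
  map_id Z := by ext x; exact Ext1.pull_id x
  map_comp b b' := by ext x; exact Ext1.pull_comp b'.unop b.unop x

instance (Z : C) : (ext1Covariant Z).Additive where
  map_add {_ _ a b} := by ext x; exact Ext1.add_push a b x

instance (X : C) : (ext1Contravariant X).Additive where
  map_add {_ _ a b} := by ext x; exact Ext1.add_pull a.unop b.unop x

end Ext
end SemiAb

/-!
Let `ξ : X ⟶ Y ⟶ Z` be stable exact with `f` irreducible and let `b : Z' ⟶ Z`. Forming `ξ b`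
factors `f` through the pullback of `g` along `b`, so by irreducibility either the first factor is
a section, and `ξ b` splits, or the second is a retraction, and `g` factors through `b`. If `b` is
a monomorphism, the second case forces `b` to be an isomorphism, because `g` is a strong
epimorphism. Since `f` is not a section, `ξ` itself does not split, so `ξ` is minimal. The case of
`g` irreducible is dual.

Minimality excludes a non-trivial decomposition `A ⊞ B`: both projections would be proper
epimorphisms, and an element of `F (A ⊞ B) ≅ F A ⊞ F B` killed by both is zero.
-/

namespace SemiAb

section Minimal

variable {C : Type u} [Category.{v} C] [Preadditive C] {F : C ⥤ Ab.{w}} [F.Additive]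

theorem IsMinimal.not_isZero {X : C} {x : F.obj X} (hx : IsMinimal F x) : ¬ IsZero X := fun hX =>
  have := AddCommGrpCat.subsingleton_of_isZero (F.map_isZero hX)
  hx.ne_zero (Subsingleton.elim x 0)

theorem IsMinimal.map_iso {X Y : C} {x : F.obj X} (hx : IsMinimal F x) (e : X ≅ Y) :
    IsMinimal F (F.map e.hom x) where
  ne_zero h := hx.ne_zero <| by
    simpa only [map_zero, ← ConcreteCategory.comp_apply, ← F.map_comp, e.hom_inv_id, F.map_id,
      ConcreteCategory.id_apply] using congrArg (F.map e.inv) h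
  map_eq_zero p _ hp := by
    rw [← ConcreteCategory.comp_apply, ← F.map_comp]
    exact hx.map_eq_zero (e.hom ≫ p) inferInstance fun _ => hp (IsIso.of_isIso_comp_left e.hom p)

theorem eq_zero_of_map_fst_of_map_snd {A B : C} [HasBinaryBiproduct A B] {x : F.obj (A ⊞ B)}
    (hfst : F.map biprod.fst x = 0) (hsnd : F.map biprod.snd x = 0) : x = 0 :=
  calc
    x = F.map (biprod.fst ≫ biprod.inl + biprod.snd ≫ biprod.inr) x := by
      rw [biprod.total, F.map_id, ConcreteCategory.id_apply]
    _ = F.map biprod.inl (F.map biprod.fst x) + F.map biprod.inr (F.map biprod.snd x) := by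
      rw [F.map_add, F.map_comp, F.map_comp]
      rfl
    _ = 0 := by rw [hfst, hsnd, map_zero, map_zero, add_zero]

theorem IsMinimal.isZero_or_isZero {A B : C} [HasBinaryBiproduct A B] {x : F.obj (A ⊞ B)}
    (hx : IsMinimal F x) : IsZero A ∨ IsZero B := by
  by_contra! ⟨hA, hB⟩
  have fst_not_isIso : ¬ IsIso (biprod.fst : A ⊞ B ⟶ A) := fun _ =>
    hB <| .of_mono_eq_zero (biprod.inr : B ⟶ A ⊞ B) <|
      zero_of_comp_mono biprod.fst biprod.inr_fst
  have snd_not_isIso : ¬ IsIso (biprod.snd : A ⊞ B ⟶ B) := fun _ =>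
    hA <| .of_mono_eq_zero (biprod.inl : A ⟶ A ⊞ B) <|
      zero_of_comp_mono biprod.snd biprod.inl_snd
  exact hx.ne_zero <| eq_zero_of_map_fst_of_map_snd
    (hx.map_eq_zero _ inferInstance fst_not_isIso) (hx.map_eq_zero _ inferInstance snd_not_isIso)

theorem IsMinimal.indecomposable [HasBinaryBiproducts C] {X : C} {x : F.obj X}
    (hx : IsMinimal F x) : Indecomposable X :=
  ⟨hx.not_isZero, fun _ _ e => (hx.map_iso e).isZero_or_isZero⟩

end Minimal

theorem indecomposable_of_op {C : Type u} [Category.{v} C] [HasZeroMorphisms C]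
    [HasBinaryBiproducts C] {X : C} (hX : Indecomposable (Opposite.op X)) : Indecomposable X :=
  ⟨fun h => hX.1 h.op, fun A B e =>
    (hX.2 _ _ (e.op.symm ≪≫ biprod.opIso A B)).imp IsZero.unop IsZero.unop⟩

section Stable

variable {C : Type u} [Category.{v} C] [Preadditive C]

theorem IsKer.strongMono {X Y Z : C} {f : X ⟶ Y} {g : Y ⟶ Z} (h : IsKer f g) : StrongMono f := by
  obtain ⟨w, ⟨hf⟩⟩ := h
  let : NormalMono f := ⟨Z, g, w, hf⟩
  infer_instance

theorem IsCoker.strongEpi {X Y Z : C} {f : X ⟶ Y} {g : Y ⟶ Z} (h : IsCoker f g) :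
    StrongEpi g := by
  obtain ⟨w, ⟨hg⟩⟩ := h
  let : NormalEpi g := ⟨X, f, w, hg⟩
  infer_instance

variable [Preabelian C] {X Z : C} {ξ η : Cplx X Z}

theorem Cplx.hasMap_split_iff : HasMap (𝟙 X) (𝟙 Z) ξ (split X Z) ↔ IsSplitMono ξ.f := by
  change (∃ v : ξ.Y ⟶ X ⊞ Z, ξ.f ≫ v = 𝟙 X ≫ biprod.inl ∧ v ≫ biprod.snd = ξ.g ≫ 𝟙 Z) ↔ _
  constructor
  · rintro ⟨v, hv, -⟩
    exact ⟨⟨⟨v ≫ biprod.fst, by simp [reassoc_of% hv]⟩⟩⟩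
  · intro _
    exact ⟨biprod.lift (retraction ξ.f) ξ.g, by ext <;> simp [ξ.w], by simp⟩

theorem Cplx.split_hasMap_iff : HasMap (𝟙 X) (𝟙 Z) (split X Z) ξ ↔ IsSplitEpi ξ.g := by
  change (∃ v : X ⊞ Z ⟶ ξ.Y, biprod.inl ≫ v = 𝟙 X ≫ ξ.f ∧ v ≫ ξ.g = biprod.snd ≫ 𝟙 Z) ↔ _
  constructor
  · rintro ⟨v, -, hv⟩
    exact ⟨⟨⟨biprod.inr ≫ v, by simp [hv]⟩⟩⟩
  · intro _
    exact ⟨biprod.desc ξ.f (section_ ξ.g), by simp, by ext <;> simp [ξ.w]⟩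

namespace Ext1

theorem mk_eq_mk_iff {hξ : ξ.IsStable} {hη : η.IsStable} :
    mk ξ hξ = mk η hη ↔ Cplx.HasMap (𝟙 X) (𝟙 Z) ξ η :=
  ⟨fun h => Cplx.Equivalent.hasMap (Quotient.exact (s := stableSetoid Z X) h), mk_eq⟩

theorem mk_eq_zero_iff_isSplitMono {hξ : ξ.IsStable} : mk ξ hξ = 0 ↔ IsSplitMono ξ.f :=
  mk_eq_mk_iff.trans Cplx.hasMap_split_iff

theorem mk_eq_zero_iff_isSplitEpi {hξ : ξ.IsStable} : mk ξ hξ = 0 ↔ IsSplitEpi ξ.g :=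
  eq_comm.trans (mk_eq_mk_iff.trans Cplx.split_hasMap_iff)

theorem pull_mk_eq_zero_or_exists_fac (hξ : ξ.IsStable) (hf : IsIrreducible ξ.f) {Z' : C}
    (b : Z' ⟶ Z) : pull b (mk ξ hξ) = 0 ∨ ∃ u : ξ.Y ⟶ Z', u ≫ b = ξ.g := by
  obtain ⟨v, hv, hfv⟩ := ξ.pull_spec b
  rcases hf.factor (ξ.pull b).f v hfv.symm with v_split | f_split
  · exact .inr ⟨section_ v ≫ (ξ.pull b).g, by
      rw [Category.assoc, ← hv.w, IsSplitEpi.id_assoc]⟩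
  · exact .inl (mk_eq_zero_iff_isSplitMono.2 f_split)

theorem push_mk_eq_zero_or_exists_fac (hξ : ξ.IsStable) (hg : IsIrreducible ξ.g) {X' : C}
    (a : X ⟶ X') : push a (mk ξ hξ) = 0 ∨ ∃ u : X' ⟶ ξ.Y, a ≫ u = ξ.f := by
  obtain ⟨v, hv, hvg⟩ := ξ.push_spec a
  rcases hg.factor v (ξ.push a).g hvg.symm with g_split | v_split
  · exact .inl (mk_eq_zero_iff_isSplitEpi.2 g_split)
  · exact .inr ⟨(ξ.push a).f ≫ retraction v, by
      rw [reassoc_of% hv.w, IsSplitMono.id, Category.comp_id]⟩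

theorem isMinimal_contravariant_mk (hξ : ξ.IsStable) (hf : IsIrreducible ξ.f) :
    IsMinimal (ext1Contravariant X) (X := Opposite.op Z) (mk ξ hξ) where
  ne_zero h := hf.not_section (mk_eq_zero_iff_isSplitMono.1 h)
  map_eq_zero b _ hb := (pull_mk_eq_zero_or_exists_fac hξ hf b.unop).resolve_right <| by
    rintro ⟨u, hu⟩
    have : StrongEpi (u ≫ b.unop) := hu ▸ hξ.shortExact.2.strongEpi
    have := strongEpi_of_strongEpi u b.unop
    exact hb ((isIso_unop_iff b).1 (isIso_of_mono_of_strongEpi b.unop))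

theorem isMinimal_covariant_mk (hξ : ξ.IsStable) (hg : IsIrreducible ξ.g) :
    IsMinimal (ext1Covariant Z) (X := X) (mk ξ hξ) where
  ne_zero h := hg.not_retraction (mk_eq_zero_iff_isSplitEpi.1 h)
  map_eq_zero a _ ha := (push_mk_eq_zero_or_exists_fac hξ hg a).resolve_right <| by
    rintro ⟨u, hu⟩
    have : StrongMono (a ≫ u) := hu ▸ hξ.shortExact.1.strongMono
    have := strongMono_of_strongMono a u
    exact ha (isIso_of_epi_of_strongMono a)

end Ext1

end Stable

end SemiAb

theorem mainTheorem5_general {C : Type u} [Category.{v} C] [Preadditive C] [SemiAb.Preabelian C]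
    {X Z : C} (ξ : SemiAb.Cplx X Z) (hξ : ξ.IsStable) :
    (SemiAb.IsIrreducible ξ.f →
      SemiAb.IsMinimal (SemiAb.ext1Contravariant X) (X := Opposite.op Z) (SemiAb.Ext1.mk ξ hξ) ∧
        Indecomposable Z) ∧
    (SemiAb.IsIrreducible ξ.g →
      SemiAb.IsMinimal (SemiAb.ext1Covariant Z) (X := X) (SemiAb.Ext1.mk ξ hξ) ∧
        Indecomposable X) := by
  refine ⟨fun hf => ?_, fun hg => ?_⟩
  · have hmin := SemiAb.Ext1.isMinimal_contravariant_mk hξ hf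
    exact ⟨hmin, SemiAb.indecomposable_of_op hmin.indecomposable⟩
  · have hmin := SemiAb.Ext1.isMinimal_covariant_mk hξ hg
    exact ⟨hmin, hmin.indecomposable⟩

theorem mainTheorem5 {C : Type u} [Category.{v} C] [Preadditive C] [SemiAb.SemiAbelian C]
    {X Z : C} (ξ : SemiAb.Cplx X Z) (hξ : ξ.IsStable) :
    (SemiAb.IsIrreducible ξ.f →
      SemiAb.IsMinimal (SemiAb.ext1Contravariant X) (X := Opposite.op Z) (SemiAb.Ext1.mk ξ hξ) ∧
        Indecomposable Z) ∧
    (SemiAb.IsIrreducible ξ.g →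
      SemiAb.IsMinimal (SemiAb.ext1Covariant Z) (X := X) (SemiAb.Ext1.mk ξ hξ) ∧
        Indecomposable X) :=
  mainTheorem5_general ξ hξ
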